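/- Let $\mathcal H$ be a separable complex Hilbert space (inner product linear in the second argument) and let $H_0\ge 0$ be a self-adjoint operator in $\mathcal H$. Let $\mathcal H_{+1}(H_0)=\operatorname{dom}(H_0^{1/2})$ with inner product $(f,g)_{+1}=(H_0^{1/2}f,H_0^{1/2}g)+(f,g)$, let $\mathcal H_{-1}(H_0)$ be the space of bounded conjugate linear functionals on $\mathcal H_{+1}(H_0)$, and let $V\in\mathcal B(\mathcal H_{+1}(H_0),\mathcal H_{-1}(H_0))$. For $z\in\rho(H_0)$ let $(H_0-z)^{-1/2}\in\mathcal B(\mathcal H)$ be the function $\lambda\mapsto(\lambda-z)^{-1/2}$ of $H_0$, where $w^{1/2}=|w|^{1/2}e^{i\arg(w)/2}$ with $\arg(w)\in[0,2\pi)$. This operator maps $\mathcal H$ boundedly into $\mathcal H_{+1}(H_0)$, and it extends to a bounded operator $\mathcal H_{-1}(H_0)\to\mathcal H$, again denoted $(H_0-z)^{-1/2}$, given by $(g,(H_0-z)^{-1/2}\Psi)=\Psi\big([(H_0-z)^{-1/2}]^*g\big)$ for $g\in\mathcal H$, $\Psi\in\mathcal H_{-1}(H_0)$. Put $$A_V(z)=-(H_0-z)^{-1/2}V(H_0-z)^{-1/2}\in\mathcal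 B(\mathcal H),\qquad z\in\rho(H_0).$$ Assume that $A_V(z_0)$ is compact for some $z_0\in\rho(H_0)$ and that $\|A_V(E_0)\|<1$ for some $E_0\in(-\infty,0)$. Let $\mathcal D=\{z\in\rho(H_0): 1\notin\rho(A_V(z))\}$ and $$R(z)=(H_0-z)^{-1/2}[I-A_V(z)]^{-1}(H_0-z)^{-1/2},\qquad z\in\rho(H_0)\setminus\mathcal D .$$ Then $\mathcal D$ is a discrete subset of $\rho(H_0)$, in the sense that it has no accumulation point in $\rho(H_0)$, and there is a densely defined closed linear operator $H$ in $\mathcal H$ such that 1. $\rho(H_0)\setminus\mathcal D\subseteq\rho(H)$ and $R(z)=(H-z)^{-1}$ for all $z\in\rho(H_0)\setminus\mathcal D$; 2. $H$ is unique, and is determined by $R(z)$ at any single point: if $z\in\rho(H_0)\setminus\mathcal D$ and $H'$ is a densely defined closed operator with $z\in\rho(H')$ and $R(z)=(H'-z)^{-1}$, then $H'=H$; 3. $(H-z)^{-1}-(H_0-z)^{-1}$ is compact for every $z\in\rho(H_0)\cap\rho(H)$. -/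

import Mathlib

open Filter Topology

noncomputable section

namespace FormPerturbation

variable {H : Type*} [NormedAddCommGroup H] [InnerProductSpace ℂ H]

/-! ### Resolvents of (unbounded) operators -/

/-- `R` is a bounded everywhere defined two-sided inverse of `T - z : dom T → H`. -/
def IsInverseAt (T : H →ₗ.[ℂ] H) (z : ℂ) (R : H →L[ℂ] H) : Prop :=
  (∀ g : H, ∃ x : T.domain, (x : H) = R g ∧ T x - z • (x : H) = g) ∧
    ∀ x : T.domain, R (T x - z • (x : H)) = x

theorem IsInverseAt.unique {T : H →ₗ.[ℂ] H} {z : ℂ} {R R' : H →L[ℂ] H}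
    (h : IsInverseAt T z R) (h' : IsInverseAt T z R') : R = R' := by
  ext g
  obtain ⟨x, hx, hxg⟩ := h.1 g
  rw [← hx, ← h'.2 x, hxg]

/-- The resolvent set `ρ(T)`. -/
def rho (T : H →ₗ.[ℂ] H) : Set ℂ := {z | ∃ R : H →L[ℂ] H, IsInverseAt T z R}

open Classical in
/-- The resolvent `(T - z)⁻¹` for `z ∈ ρ(T)` (and `0` for other `z`). -/
def res (T : H →ₗ.[ℂ] H) (z : ℂ) : H →L[ℂ] H :=
  if h : ∃ R : H →L[ℂ] H, IsInverseAt T z R then h.choose else 0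

theorem isInverseAt_res {T : H →ₗ.[ℂ] H} {z : ℂ} (hz : z ∈ rho T) : IsInverseAt T z (res T z) := by
  have h : ∃ R : H →L[ℂ] H, IsInverseAt T z R := hz
  rw [res, dif_pos h]
  exact h.choose_spec

theorem IsInverseAt.res_eq {T : H →ₗ.[ℂ] H} {z : ℂ} {R : H →L[ℂ] H} (h : IsInverseAt T z R) :
    res T z = R :=
  (isInverseAt_res ⟨R, h⟩).unique h

/-! ### Functions of a nonnegative self-adjoint operator -/

/-- The argument of `w` in `[0, 2π)`. -/
def argNonneg (w : ℂ) : ℝ := if w.arg < 0 then w.arg + 2 * Real.pi else w.arg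

/-- The branch `w ^ (1/2) = |w| ^ (1/2) * exp (i arg w / 2)` with `arg w ∈ [0, 2π)`. -/
def csqrt (w : ℂ) : ℂ := (Real.sqrt ‖w‖ : ℂ) * Complex.exp (((argNonneg w / 2 : ℝ) : ℂ) * Complex.I)

variable [CompleteSpace H]

/-- The bounded operator `φ(H₀)`, where `H₀` is self-adjoint and nonnegative and `φ` is continuous
on `σ(H₀)` and tends to `0` at `∞` (if `H₀` is unbounded).  Under `t = (1 + λ)⁻¹` the spectral
variable `λ ∈ σ(H₀)` of `H₀` becomes the spectral variable `t` of the bounded self-adjoint operator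
`(H₀ + 1)⁻¹`; so `φ(H₀)` is obtained by applying `t ↦ φ (t⁻¹ - 1)` to `(H₀ + 1)⁻¹`.  The point
`t = 0` stands for `λ = ∞`. -/
def funCalc (H₀ : H →ₗ.[ℂ] H) (φ : ℝ → ℂ) : H →L[ℂ] H :=
  cfc (fun t : ℂ => if t = 0 then 0 else φ (t.re⁻¹ - 1)) (res H₀ (-1))

/-- `(H₀ - z) ^ (-1/2)` for `z ∈ ρ(H₀)`, that is `φ(H₀)` for `φ(λ) = 1 / (λ - z) ^ (1/2)`. -/
def invSqrt (H₀ : H →ₗ.[ℂ] H) (z : ℂ) : H →L[ℂ] H :=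
  funCalc H₀ fun l : ℝ => (csqrt ((l : ℂ) - z))⁻¹

/-- The nonnegative self-adjoint square root `H₀ ^ (1/2)`.  With `T = (H₀ + 1)⁻¹`, which satisfies
`0 ≤ T ≤ 1` and is injective, one has `H₀ = (1 - T) T⁻¹` and
`H₀ ^ (1/2) = (1 - T) ^ (1/2) (T ^ (1/2))⁻¹` with domain `ran (T ^ (1/2))`. -/
def opSqrt (H₀ : H →ₗ.[ℂ] H) : H →ₗ.[ℂ] H :=
  (CFC.sqrt (1 - res H₀ (-1)) : H →L[ℂ] H).toLinearMap.compPMap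
    ((CFC.sqrt (res H₀ (-1)) : H →L[ℂ] H).toLinearMap.toPMap ⊤).inverse

/-! ### The scale of spaces -/

/-- The space `𝓗₊₁(H₀) = dom (H₀ ^ (1/2))`, with the inner product
`(f, g)₊₁ = (H₀ ^ (1/2) f, H₀ ^ (1/2) g) + (f, g)`. -/
def HPlus (H₀ : H →ₗ.[ℂ] H) : Type _ := (opSqrt H₀).domain

namespace HPlus

variable (H₀ : H →ₗ.[ℂ] H)

/-- The vector space structure of `𝓗₊₁(H₀)`, inherited from `𝓗`. -/
@[reducible] def addCommGroup : AddCommGroup (HPlus H₀) :=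
  inferInstanceAs (AddCommGroup (opSqrt H₀).domain)

section

attribute [local instance] addCommGroup

/-- The vector space structure of `𝓗₊₁(H₀)`, inherited from `𝓗`. -/
@[reducible] def module : Module ℂ (HPlus H₀) :=
  inferInstanceAs (Module ℂ (opSqrt H₀).domain)

attribute [local instance] module

/-- The inner product of `𝓗₊₁(H₀)`. -/
@[reducible] def core : InnerProductSpace.Core ℂ (HPlus H₀) :=
  let S : HPlus H₀ →ₗ[ℂ] H := (opSqrt H₀).toFun
  let J : HPlus H₀ →ₗ[ℂ] H := (opSqrt H₀).domain.subtype
  { inner := fun f g => inner ℂ (S f) (S g) + inner ℂ (J f) (J g)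
    conj_inner_symm := fun f g => by simp
    re_inner_nonneg := fun f => by
      simpa using add_nonneg (inner_self_nonneg (𝕜 := ℂ) (x := S f))
        (inner_self_nonneg (𝕜 := ℂ) (x := J f))
    add_left := fun f g h => by simp only [map_add, inner_add_left]; ring
    smul_left := fun f g c => by simp only [map_smul, inner_smul_left]; ring
    definite := fun f hf => by
      have h1 := inner_self_nonneg (𝕜 := ℂ) (x := S f)
      have h2 := inner_self_nonneg (𝕜 := ℂ) (x := J f)
      have h3 : RCLike.re (inner ℂ (S f) (S f)) + RCLike.re (inner ℂ (J f) (J f)) = 0 := by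
        rw [← map_add, hf, map_zero]
      have h4 : RCLike.re (inner ℂ (J f) (J f)) = 0 := by linarith
      rw [← norm_sq_eq_re_inner] at h4
      have h5 : J f = 0 := by simpa using h4
      exact Subtype.ext h5 }

instance instNormedAddCommGroup : NormedAddCommGroup (HPlus H₀) :=
  @InnerProductSpace.Core.toNormedAddCommGroup ℂ (HPlus H₀) _ _ _ (core H₀)

instance instInnerProductSpace : InnerProductSpace ℂ (HPlus H₀) :=
  InnerProductSpace.ofCore (core H₀).toCore

end

/-- The inclusion `𝓗₊₁(H₀) ⊆ 𝓗`. -/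
def incl : HPlus H₀ →ₗ[ℂ] H := (opSqrt H₀).domain.subtype

/-- `H₀ ^ (1/2)` as a map `𝓗₊₁(H₀) → 𝓗`. -/
def sqrtMap : HPlus H₀ →ₗ[ℂ] H := (opSqrt H₀).toFun

theorem inner_def (f g : HPlus H₀) :
    inner ℂ f g = inner ℂ (sqrtMap H₀ f) (sqrtMap H₀ g) + inner ℂ (incl H₀ f) (incl H₀ g) := rfl

end HPlus

/-- The space `𝓗₋₁(H₀)` of bounded conjugate linear functionals on `𝓗₊₁(H₀)`. -/
abbrev HMinus (H₀ : H →ₗ.[ℂ] H) : Type _ := HPlus H₀ →L⋆[ℂ] ℂ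

open Classical in
/-- A bounded operator `B` in `𝓗` that maps `𝓗` boundedly into `𝓗₊₁(H₀)`, regarded as a bounded map
`𝓗 → 𝓗₊₁(H₀)` (and `0` for other `B`).  It is used for `B = (H₀ - z) ^ (-1/2)` and for the adjoint of
this operator, where `z ∈ ρ(H₀)`; both map `𝓗` boundedly into `𝓗₊₁(H₀)`. -/
def toPlus (H₀ : H →ₗ.[ℂ] H) (B : H →L[ℂ] H) : H →L[ℂ] HPlus H₀ :=
  if h : ∃ L : H →L[ℂ] HPlus H₀, ∀ f, HPlus.incl H₀ (L f) = B f then h.choose else 0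

theorem toPlus_eq {H₀ : H →ₗ.[ℂ] H} {B : H →L[ℂ] H} {L : H →L[ℂ] HPlus H₀}
    (h : ∀ f, HPlus.incl H₀ (L f) = B f) : toPlus H₀ B = L := by
  have h' : ∃ L : H →L[ℂ] HPlus H₀, ∀ f, HPlus.incl H₀ (L f) = B f := ⟨L, h⟩
  rw [toPlus, dif_pos h']
  ext f
  exact Subtype.ext ((h'.choose_spec f).trans (h f).symm)

/-- The extension of a bounded operator `B` in `𝓗` to a bounded map `𝓗₋₁(H₀) → 𝓗`, by duality:
`(g, B Ψ) = Ψ (B* g)` for `Ψ ∈ 𝓗₋₁(H₀)` and `g ∈ 𝓗`, with `B Ψ ∈ 𝓗` obtained from the Riesz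
representation theorem. -/
def fromMinus (H₀ : H →ₗ.[ℂ] H) (B : H →L[ℂ] H) : HMinus H₀ →L[ℂ] H :=
  LinearMap.mkContinuous
    { toFun := fun Ψ : HMinus H₀ => (InnerProductSpace.toDual ℂ H).symm
        ((starL ℂ : ℂ ≃L⋆[ℂ] ℂ).toContinuousLinearMap.comp
          (Ψ.comp (toPlus H₀ (ContinuousLinearMap.adjoint B))))
      map_add' := fun (Ψ Φ : HMinus H₀) => by
        refine ext_inner_right ℂ fun g => ?_
        simp [inner_add_left]
      map_smul' := fun (c : ℂ) (Ψ : HMinus H₀) => by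
        refine ext_inner_right ℂ fun g => ?_
        simp [inner_smul_left] }
    ‖toPlus H₀ (ContinuousLinearMap.adjoint B)‖
    (fun Ψ : HMinus H₀ => by
      simp only [LinearMap.coe_mk, AddHom.coe_mk, LinearIsometryEquiv.norm_map]
      refine ContinuousLinearMap.opNorm_le_bound _ (by positivity) fun g => ?_
      have h1 := Ψ.le_opNorm (toPlus H₀ (ContinuousLinearMap.adjoint B) g)
      have h2 := (toPlus H₀ (ContinuousLinearMap.adjoint B)).le_opNorm g
      have h3 : ‖Ψ‖ * ‖toPlus H₀ (ContinuousLinearMap.adjoint B) g‖ ≤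
          ‖Ψ‖ * (‖toPlus H₀ (ContinuousLinearMap.adjoint B)‖ * ‖g‖) :=
        mul_le_mul_of_nonneg_left h2 (norm_nonneg _)
      simp only [ContinuousLinearMap.comp_apply, ContinuousLinearEquiv.coe_coe, starL_apply,
        norm_star]
      linarith)

theorem inner_fromMinus (H₀ : H →ₗ.[ℂ] H) (B : H →L[ℂ] H) (Ψ : HMinus H₀) (g : H) :
    inner ℂ g (fromMinus H₀ B Ψ) = Ψ (toPlus H₀ (ContinuousLinearMap.adjoint B) g) := by
  rw [← inner_conj_symm]
  simp [fromMinus]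

/-! ### The operators `A_V(z)` and `R(z)` -/

/-- `A_V(z) = -(H₀ - z) ^ (-1/2) V (H₀ - z) ^ (-1/2)`, where the right factor maps `𝓗` to `𝓗₊₁(H₀)`
and the left factor maps `𝓗₋₁(H₀)` to `𝓗`. -/
def birmanSchwinger (H₀ : H →ₗ.[ℂ] H) (V : HPlus H₀ →L[ℂ] HMinus H₀) (z : ℂ) : H →L[ℂ] H :=
  -((fromMinus H₀ (invSqrt H₀ z)).comp (V.comp (toPlus H₀ (invSqrt H₀ z))))

/-- The exceptional set: all `z ∈ ρ(H₀)` with `1 ∉ ρ(A_V(z))`. -/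
def exceptionalSet (H₀ : H →ₗ.[ℂ] H) (V : HPlus H₀ →L[ℂ] HMinus H₀) : Set ℂ :=
  {z | z ∈ rho H₀ ∧ (1 : ℂ) ∉ resolventSet ℂ (birmanSchwinger H₀ V z)}

/-- `R(z) = (H₀ - z) ^ (-1/2) (1 - A_V(z))⁻¹ (H₀ - z) ^ (-1/2)`. -/
def tiktopoulos (H₀ : H →ₗ.[ℂ] H) (V : HPlus H₀ →L[ℂ] HMinus H₀) (z : ℂ) : H →L[ℂ] H :=
  invSqrt H₀ z * Ring.inverse (1 - birmanSchwinger H₀ V z) * invSqrt H₀ z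

end FormPerturbation

end

/-! With `T = (H₀ + 1)⁻¹`, so that `0 ≤ T ≤ 1`, all operators become bounded. Put `v = T^(1/2) V
T^(1/2)` and `P(z) = 1 - (1 + z) T + v`, formally `T^(1/2) (H₀ + V - z) T^(1/2)`. On `ρ(H₀)` one has
`(H₀ - z)^(-1/2) = T^(1/2) B`, where `B = (1 - (1 + z) T)^(-1/2)` is invertible and commutes with
`T^(1/2)` (`invSqrt_eq`). Hence `1 - A_V(z) = B P(z) B` and `R(z) = T^(1/2) P(z)⁻¹ T^(1/2)`
(`tiktopoulos_eq`). The branch of the root has cancelled, `P` is affine in `z`, and no continuity of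
`A_V` in `z` is needed.

Compactness of `A_V(z₀) = -B v B` is compactness of `v`, and `‖A_V(E₀)‖ < 1` makes `P(E₀)`
invertible. Since `1 - (1 + z) T` is invertible on the connected set `ρ(H₀)`, the analytic Fredholm
alternative gives discreteness.

From `P(w) - P(z) = (z - w) T` the `R(z)` satisfy the resolvent identity. `R(E₀)` is injective with
dense range, hence the resolvent at `E₀` of a densely defined operator, and the identity transports
this to every nonexceptional `z`. A resolvent at one point determines the graph, which gives
uniqueness and closedness. The resolvent difference contains the compact factor `v` at `E₀`, and
compactness passes from `E₀` to every common point of the resolvent sets. -/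

noncomputable section

namespace FormPerturbation

/-! ### The analytic Fredholm alternative -/

section Fredholm

variable {H : Type*} [NormedAddCommGroup H] [InnerProductSpace ℂ H]

/-- A compact operator with values in a Hilbert space is a norm limit of operators of finite
rank. -/
theorem exists_finiteRank_approx {v : H →L[ℂ] H} (hv : IsCompactOperator v) {δ : ℝ} (hδ : 0 < δ) :
    ∃ (n : ℕ) (p : H →L[ℂ] EuclideanSpace ℂ (Fin n)) (i : EuclideanSpace ℂ (Fin n) →L[ℂ] H),
      ‖v - i.comp p‖ < δ := by
  obtain ⟨K, hK, hsub⟩ := IsCompactOperator.image_closedBall_subset_compact (f := (v : H →ₗ[ℂ] H)) hv 1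
  obtain ⟨t, -, ht, hcov⟩ := hK.finite_cover_balls (half_pos hδ)
  -- The approximant is the orthogonal projection of `v` onto the span of a finite `δ / 2`-net for
  -- the image of the unit ball. The projection is the nearest point of the span, so it errs no more
  -- than the net does.
  let W : Submodule ℂ H := Submodule.span ℂ t
  have : FiniteDimensional ℂ W := FiniteDimensional.span_of_finite ℂ ht
  let b := stdOrthonormalBasis ℂ W
  refine ⟨Module.finrank ℂ W,
    (b.repr.toContinuousLinearEquiv : W →L[ℂ] _).comp (W.orthogonalProjectionOnto.comp v),
    W.subtypeL.comp (b.repr.symm.toContinuousLinearEquiv : _ →L[ℂ] W), ?_⟩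
  refine lt_of_le_of_lt ?_ (half_lt_self hδ)
  refine ContinuousLinearMap.opNorm_le_of_unit_norm (half_pos hδ).le fun x hx => ?_
  have hvx : v x ∈ K := hsub ⟨x, by simp [hx], rfl⟩
  obtain ⟨y, hy, hxy⟩ := Set.mem_iUnion₂.1 (hcov hvx)
  have hyW : y ∈ W := Submodule.subset_span hy
  have h1 : ‖v x - W.orthogonalProjectionOnto (v x)‖ ≤ ‖v x - y‖ := by
    have := W.starProjection_minimal (v x)
    rw [Submodule.starProjection_apply] at this
    rw [this]
    exact ciInf_le ⟨0, by rintro _ ⟨w, rfl⟩; positivity⟩ (⟨y, hyW⟩ : W)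
  have h2 : ‖v x - y‖ < δ / 2 := by simpa [dist_eq_norm] using hxy
  simpa using h1.trans h2.le

/-- Sylvester's identity for invertibility, with a perturbation of finite rank. -/
theorem isUnit_add_comp_iff {E : Type*} [NormedAddCommGroup E] [NormedSpace ℂ E]
    {e : H →L[ℂ] H} (he : IsUnit e) (p : H →L[ℂ] E) (i : E →L[ℂ] H) :
    IsUnit (e + i.comp p) ↔ IsUnit (1 + p.comp ((Ring.inverse e).comp i)) := by
  obtain ⟨u, rfl⟩ := he
  rw [Ring.inverse_unit]
  set u' : H →L[ℂ] H := ((u⁻¹ : (H →L[ℂ] H)ˣ) : H →L[ℂ] H) with hu'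
  have hl : ∀ x, u' ((u : H →L[ℂ] H) x) = x := fun x => by
    rw [← mul_apply_eq_comp, hu', Units.inv_mul]; rfl
  have hr : ∀ x, (u : H →L[ℂ] H) (u' x) = x := fun x => by
    rw [← mul_apply_eq_comp, hu', Units.mul_inv]; rfl
  constructor
  · intro h
    obtain ⟨w, hw⟩ := h
    set w' : H →L[ℂ] H := ((w⁻¹ : (H →L[ℂ] H)ˣ) : H →L[ℂ] H) with hw'
    have wl : ∀ x, w' ((u : H →L[ℂ] H) x + i (p x)) = x := fun x => by
      have : w' ((w : H →L[ℂ] H) x) = x := by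
        rw [← mul_apply_eq_comp, hw', Units.inv_mul]; rfl
      rwa [hw] at this
    have wr : ∀ x, (u : H →L[ℂ] H) (w' x) + i (p (w' x)) = x := fun x => by
      have : (w : H →L[ℂ] H) (w' x) = x := by
        rw [← mul_apply_eq_comp, hw', Units.mul_inv]; rfl
      rwa [hw] at this
    -- Woodbury: `(1 + p e⁻¹ i)⁻¹ = 1 - p (e + i p)⁻¹ i`.
    refine isUnit_iff_exists.2 ⟨1 - p.comp (w'.comp i), ?_, ?_⟩
    · ext x
      simp only [mul_apply_eq_comp, add_apply,
        sub_apply, one_apply_eq_self,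
        ContinuousLinearMap.comp_apply, map_sub]
      have h1 : i (p (w' (i x))) = i x - (u : H →L[ℂ] H) (w' (i x)) :=
        eq_sub_of_add_eq' (wr (i x))
      rw [h1, map_sub, hl, map_sub]
      abel
    · ext x
      simp only [mul_apply_eq_comp, add_apply,
        sub_apply, one_apply_eq_self,
        ContinuousLinearMap.comp_apply, map_add]
      have h1 : w' (i (p (u' (i x)))) = u' (i x) - w' (i x) := by
        have := wl (u' (i x))
        rw [hr, map_add] at this
        exact eq_sub_of_add_eq' this
      rw [h1, map_sub]
      abel
  · intro h
    obtain ⟨w, hw⟩ := h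
    set w' : E →L[ℂ] E := ((w⁻¹ : (E →L[ℂ] E)ˣ) : E →L[ℂ] E) with hw'
    have wl : ∀ x, w' (x + p (u' (i x))) = x := fun x => by
      have : w' ((w : E →L[ℂ] E) x) = x := by
        rw [← mul_apply_eq_comp, hw', Units.inv_mul]; rfl
      rwa [hw] at this
    have wr : ∀ x, w' x + p (u' (i (w' x))) = x := fun x => by
      have : (w : E →L[ℂ] E) (w' x) = x := by
        rw [← mul_apply_eq_comp, hw', Units.mul_inv]; rfl
      rwa [hw] at this
    -- Conversely, `(e + i p)⁻¹ = e⁻¹ - e⁻¹ i (1 + p e⁻¹ i)⁻¹ p e⁻¹`.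
    refine isUnit_iff_exists.2 ⟨u' - u'.comp (i.comp (w'.comp (p.comp u'))), ?_, ?_⟩
    · ext x
      simp only [mul_apply_eq_comp, add_apply,
        sub_apply, one_apply_eq_self,
        ContinuousLinearMap.comp_apply, map_sub, hr]
      have h1 : p (u' (i (w' (p (u' x))))) = p (u' x) - w' (p (u' x)) :=
        eq_sub_of_add_eq' (wr (p (u' x)))
      rw [h1, map_sub]
      abel
    · ext x
      simp only [mul_apply_eq_comp, add_apply,
        sub_apply, one_apply_eq_self,
        ContinuousLinearMap.comp_apply, map_add, hl]
      have h1 : w' (p (u' (i (p x)))) = p x - w' (p x) := by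
        have := wl (p x)
        rw [map_add] at this
        exact eq_sub_of_add_eq' this
      rw [h1, map_sub]
      simp only [map_sub]
      abel

/-- In finite dimension, an analytic family of operators is either singular in a neighbourhood of
a point or invertible in a punctured neighbourhood. -/
theorem eventually_isUnit_finiteDim {n : ℕ}
    {f : ℂ → EuclideanSpace ℂ (Fin n) →L[ℂ] EuclideanSpace ℂ (Fin n)} {z : ℂ}
    (hf : AnalyticAt ℂ f z) :
    (∀ᶠ w in 𝓝 z, ¬ IsUnit (f w)) ∨ ∀ᶠ w in 𝓝[≠] z, IsUnit (f w) := by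
  let b := (EuclideanSpace.basisFun (Fin n) ℂ).toBasis
  -- The Leibniz expansion makes the determinant a polynomial in the matrix entries, which are
  -- continuous linear in `f w`. Its zeros are then isolated unless it vanishes near `z`.
  have hdet : AnalyticAt ℂ (fun w => (f w).det) z := by
    have : (fun w => (f w).det) = fun w =>
        ∑ σ : Equiv.Perm (Fin n), Equiv.Perm.sign σ •
          ∏ j, EuclideanSpace.proj (𝕜 := ℂ) (σ j) (f w (b j)) := by
      funext w
      rw [ContinuousLinearMap.det, ← LinearMap.det_toMatrix b, Matrix.det_apply]
      simp [LinearMap.toMatrix_apply, b]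
    rw [this]
    refine Finset.analyticAt_fun_sum _ fun σ _ => ?_
    have hprod : AnalyticAt ℂ
        (fun w => ∏ j, EuclideanSpace.proj (𝕜 := ℂ) (σ j) (f w (b j))) z := by
      refine Finset.analyticAt_fun_prod _ fun j _ => ?_
      exact ((EuclideanSpace.proj (𝕜 := ℂ) (σ j)).comp
        (ContinuousLinearMap.apply ℂ (EuclideanSpace ℂ (Fin n)) (b j))).analyticAt _ |>.comp hf
    rcases Int.units_eq_one_or (Equiv.Perm.sign σ) with h | h <;> rw [h]
    · simpa using hprod
    · simp only [Units.neg_smul, one_smul]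
      exact hprod.neg
  have hiff : ∀ w, IsUnit (f w) ↔ (f w).det ≠ 0 := fun w => by
    rw [ContinuousLinearMap.det, ← isUnit_iff_ne_zero, ← LinearMap.isUnit_iff_isUnit_det]
    exact (MulEquiv.isUnit_map
      (Module.End.toContinuousLinearMap (𝕜 := ℂ) (EuclideanSpace ℂ (Fin n))).symm.toMulEquiv).symm
  simp only [hiff, not_not]
  exact hdet.eventually_eq_zero_or_eventually_ne_zero

variable [CompleteSpace H]

/-- The local form of the analytic Fredholm alternative. -/
theorem eventually_isUnit_add_compact {G : ℂ → H →L[ℂ] H} {z : ℂ} (hG : AnalyticAt ℂ G z)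
    (hz : IsUnit (G z)) {v : H →L[ℂ] H} (hv : IsCompactOperator v) :
    (∀ᶠ w in 𝓝 z, ¬ IsUnit (G w + v)) ∨ ∀ᶠ w in 𝓝[≠] z, IsUnit (G w + v) := by
  obtain ⟨δ, hδ, hball⟩ := Metric.isOpen_iff.1 (Units.isOpen (R := H →L[ℂ] H)) (G z) hz
  obtain ⟨n, p, i, hpi⟩ := exists_finiteRank_approx hv hδ
  -- `δ` is chosen so that `e z` is still invertible. Then `G + v = e + i p` is a finite-rank
  -- perturbation of an invertible family, and Sylvester's identity reduces it to finite dimension.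
  let e : ℂ → H →L[ℂ] H := fun w => G w + (v - i.comp p)
  have hez : IsUnit (e z) := hball (by simpa [e, dist_eq_norm] using hpi)
  have he : AnalyticAt ℂ e z := hG.add analyticAt_const
  have hunit : ∀ᶠ w in 𝓝 z, IsUnit (e w) :=
    he.continuousAt.eventually (Units.isOpen.mem_nhds hez)
  have hinv : AnalyticAt ℂ (fun w => Ring.inverse (e w)) z := by
    obtain ⟨u, hu⟩ := hez
    exact (hu ▸ analyticAt_inverse (𝕜 := ℂ) u : AnalyticAt ℂ Ring.inverse (e z)).comp he
  let L : (H →L[ℂ] H) →L[ℂ] EuclideanSpace ℂ (Fin n) →L[ℂ] EuclideanSpace ℂ (Fin n) :=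
    (ContinuousLinearMap.compL ℂ _ _ _ p).comp ((ContinuousLinearMap.compL ℂ _ _ _).flip i)
  have hf : AnalyticAt ℂ (fun w => 1 + p.comp ((Ring.inverse (e w)).comp i)) z :=
    analyticAt_const.add ((L.analyticAt _).comp hinv)
  have key : ∀ᶠ w in 𝓝 z, (IsUnit (G w + v) ↔
      IsUnit (1 + p.comp ((Ring.inverse (e w)).comp i))) := by
    filter_upwards [hunit] with w hw
    rw [← isUnit_add_comp_iff hw p i]
    simp [e, add_assoc]
  refine (eventually_isUnit_finiteDim hf).imp (fun h => ?_) fun h => ?_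
  · filter_upwards [h, key] with w h1 h2 using fun h3 => h1 (h2.1 h3)
  · filter_upwards [h, key.filter_mono nhdsWithin_le_nhds] with w h1 h2 using h2.2 h1

/-- The analytic Fredholm alternative: on a connected set, an analytic family of compact
perturbations of invertible operators which is invertible at one point is invertible in a punctured
neighbourhood of every point. -/
theorem eventually_isUnit_of_isPreconnected {G : ℂ → H →L[ℂ] H} {Ω : Set ℂ}
    (hconn : IsPreconnected Ω) (hG : ∀ z ∈ Ω, AnalyticAt ℂ G z) (hunit : ∀ z ∈ Ω, IsUnit (G z))
    {v : H →L[ℂ] H} (hv : IsCompactOperator v) {z₀ : ℂ} (hz₀ : z₀ ∈ Ω) (h₀ : IsUnit (G z₀ + v))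
    {z : ℂ} (hz : z ∈ Ω) : ∀ᶠ w in 𝓝[≠] z, IsUnit (G w + v) := by
  have alt := fun w hw => eventually_isUnit_add_compact (hG w hw) (hunit w hw) hv
  by_contra hcon
  -- The two local alternatives define disjoint open sets that cover `Ω`, and each would meet it.
  let U : Set ℂ := {w | ∀ᶠ x in 𝓝 w, ¬ IsUnit (G x + v)}
  have hU : IsOpen U := isOpen_setOfPred_eventually_nhds
  have hV : IsOpen {w | ∀ᶠ x in 𝓝[≠] w, IsUnit (G x + v)} := by
    refine isOpen_iff_mem_nhds.2 fun w hw => ?_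
    have hw' := eventually_eventually_nhds.2 (eventually_nhdsWithin_iff.1 hw)
    filter_upwards [hw'] with y hy
    rcases eq_or_ne y w with rfl | hyw
    · exact hw
    · refine Filter.Eventually.filter_mono nhdsWithin_le_nhds ?_
      filter_upwards [hy, isOpen_ne.mem_nhds hyw] with x hx hxw using hx hxw
  have hnot : ∀ w, (∀ᶠ x in 𝓝 w, ¬ IsUnit (G x + v)) →
      ¬ ∀ᶠ x in 𝓝[≠] w, IsUnit (G x + v) := fun w h1 h2 => by
    obtain ⟨x, hx1, hx2⟩ := ((h1.filter_mono nhdsWithin_le_nhds).and h2).exists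
    exact hx1 hx2
  obtain ⟨w, -, hw1, hw2⟩ := hconn _ _ hU hV (fun w hw => alt w hw)
    ⟨z, hz, (alt z hz).resolve_right hcon⟩
    ⟨z₀, hz₀, (alt z₀ hz₀).resolve_left fun h => h.self_of_nhds h₀⟩
  exact hnot w hw1 hw2

end Fredholm

/-! ### Resolvents -/

section Resolvents

variable {H : Type*} [NormedAddCommGroup H] [InnerProductSpace ℂ H]

/-- Substituting `g = y - z • x` merges both halves of the inverse property into a description of
the graph by `R` and `z` alone. Uniqueness, closedness and the construction of an operator from its
resolvent are read off from it. -/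
theorem isInverseAt_iff_mem_graph {T : H →ₗ.[ℂ] H} {z : ℂ} {R : H →L[ℂ] H} :
    IsInverseAt T z R ↔ ∀ x y : H, (x, y) ∈ T.graph ↔ R (y - z • x) = x := by
  constructor
  · intro h x y
    constructor
    · intro hxy
      obtain ⟨x', hx', hy'⟩ := (LinearPMap.mem_graph_iff T).1 hxy
      simp only at hx' hy'
      rw [← hx', ← hy']
      exact h.2 x'
    · intro hR
      obtain ⟨x', hx', hy'⟩ := h.1 (y - z • x)
      rw [hR] at hx'
      refine (LinearPMap.mem_graph_iff T).2 ⟨x', hx', ?_⟩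
      rw [hx'] at hy'
      exact sub_left_injective hy'
  · intro h
    constructor
    · intro g
      have : (R g, g + z • R g) ∈ T.graph := (h _ _).2 (by simp)
      obtain ⟨x', hx', hy'⟩ := (LinearPMap.mem_graph_iff T).1 this
      simp only at hx' hy'
      exact ⟨x', hx', by rw [hy', hx']; simp⟩
    · intro x
      exact (h _ _).1 (T.mem_graph x)

/-- An operator is determined by its resolvent at a single point. -/
theorem IsInverseAt.operator_unique {T T' : H →ₗ.[ℂ] H} {z : ℂ} {R : H →L[ℂ] H}
    (h : IsInverseAt T z R) (h' : IsInverseAt T' z R) : T = T' := by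
  refine LinearPMap.eq_of_eq_graph ?_
  ext ⟨x, y⟩
  rw [isInverseAt_iff_mem_graph.1 h, isInverseAt_iff_mem_graph.1 h']

/-- An operator with nonempty resolvent set is closed. -/
theorem IsInverseAt.isClosed {T : H →ₗ.[ℂ] H} {z : ℂ} {R : H →L[ℂ] H}
    (h : IsInverseAt T z R) : T.IsClosed := by
  have : (T.graph : Set (H × H)) = {p | R (p.2 - z • p.1) = p.1} := by
    ext ⟨x, y⟩
    exact isInverseAt_iff_mem_graph.1 h x y
  rw [LinearPMap.IsClosed, this]
  exact isClosed_eq (by fun_prop) (by fun_prop)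

theorem IsInverseAt.domain_eq {T : H →ₗ.[ℂ] H} {z : ℂ} {R : H →L[ℂ] H}
    (h : IsInverseAt T z R) : (T.domain : Set H) = Set.range R := by
  ext x
  constructor
  · intro hx
    exact ⟨_, h.2 ⟨x, hx⟩⟩
  · rintro ⟨g, rfl⟩
    obtain ⟨x, hx, -⟩ := h.1 g
    rw [← hx]
    exact x.2

theorem IsInverseAt.injective {T : H →ₗ.[ℂ] H} {z : ℂ} {R : H →L[ℂ] H}
    (h : IsInverseAt T z R) : Function.Injective R := by
  refine (injective_iff_map_eq_zero R).2 fun g hg => ?_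
  obtain ⟨x, hx, hxg⟩ := h.1 g
  have hx0 : x = 0 := Subtype.ext (hx.trans hg)
  rw [← hxg, hx0]
  simp

/-- The first resolvent identity. -/
theorem IsInverseAt.sub_eq {T : H →ₗ.[ℂ] H} {z w : ℂ} {R S : H →L[ℂ] H}
    (hR : IsInverseAt T z R) (hS : IsInverseAt T w S) : R - S = (z - w) • (R * S) := by
  ext g
  obtain ⟨x, hx, hxg⟩ := hS.1 g
  have h1 := hR.2 x
  have h2 : T x - z • (x : H) = g - (z - w) • S g := by
    rw [← hx, ← hxg]; module
  rw [h2, map_sub, map_smul, hx] at h1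
  simp only [sub_apply, smul_apply, mul_apply_eq_comp]
  rw [sub_eq_iff_eq_add, ← sub_eq_iff_eq_add', h1]

/-- The operator with prescribed injective resolvent at a point. -/
theorem exists_isInverseAt {R : H →L[ℂ] H} (hR : Function.Injective R) (z : ℂ) :
    ∃ T : H →ₗ.[ℂ] H, IsInverseAt T z R := by
  -- The kernel of `Φ` is the required graph; injectivity of `R` makes it single-valued.
  let Φ : H × H →ₗ[ℂ] H := (R : H →ₗ[ℂ] H) ∘ₗ (LinearMap.snd ℂ H H - z • LinearMap.fst ℂ H H) -
    LinearMap.fst ℂ H H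
  have hΦ : ∀ x y : H, (x, y) ∈ LinearMap.ker Φ ↔ R (y - z • x) = x := fun x y => by
    simp [Φ, sub_eq_zero]
  refine ⟨(LinearMap.ker Φ).toLinearPMap, isInverseAt_iff_mem_graph.2 fun x y => ?_⟩
  rw [Submodule.toLinearPMap_graph_eq, hΦ]
  rintro ⟨x, y⟩ hxy (rfl : x = 0)
  have := (hΦ _ _).1 hxy
  exact hR (by simpa using this)

/-- A pseudoresolvent that is a resolvent at one point is a resolvent at the others. -/
theorem IsInverseAt.of_sub_eq {T : H →ₗ.[ℂ] H} {z w : ℂ} {R S : H →L[ℂ] H}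
    (hS : IsInverseAt T w S) (h₁ : R - S = (z - w) • (R * S)) (h₂ : R - S = (z - w) • (S * R)) :
    IsInverseAt T z R := by
  -- Each order of the product in the resolvent identity gives one inclusion between the two
  -- descriptions of the graph.
  have key : ∀ {z w : ℂ} {R S : H →L[ℂ] H}, R - S = (z - w) • (R * S) →
      ∀ x y : H, S (y - w • x) = x → R (y - z • x) = x := by
    intro z w R S h x y hx
    have h3 := DFunLike.congr_fun h (y - w • x)
    simp only [sub_apply, smul_apply, mul_apply_eq_comp] at h3
    rw [hx] at h3
    have h4 : y - z • x = (y - w • x) - (z - w) • x := by module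
    rw [h4, map_sub, map_smul, ← h3]
    abel
  have h₂' : S - R = (w - z) • (S * R) := by rw [← neg_sub R S, h₂, ← neg_smul, neg_sub]
  refine isInverseAt_iff_mem_graph.2 fun x y => ?_
  rw [isInverseAt_iff_mem_graph.1 hS]
  exact ⟨key h₁ x y, key h₂' x y⟩

end Resolvents

/-! ### The resolvent of a nonnegative self-adjoint operator at `-1` -/

section NonnegSelfAdjoint

variable {H : Type*} [NormedAddCommGroup H] [InnerProductSpace ℂ H] [CompleteSpace H]
  {H₀ : H →ₗ.[ℂ] H}

theorem inner_symm_of_isSelfAdjoint (hsa : IsSelfAdjoint H₀) (x y : H₀.domain) :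
    inner ℂ (H₀ x) (y : H) = inner ℂ (x : H) (H₀ y) := by
  have h := LinearPMap.adjoint_isFormalAdjoint hsa.dense_domain
  rw [LinearPMap.isSelfAdjoint_def.1 hsa] at h
  exact h x y

omit [CompleteSpace H] in
theorem norm_le_norm_add_of_nonneg (hnonneg : ∀ x : H₀.domain, 0 ≤ (inner ℂ (x : H) (H₀ x)).re)
    (x : H₀.domain) : ‖(x : H)‖ ≤ ‖H₀ x + x‖ := by
  have h1 : ‖(x : H)‖ ^ 2 ≤ (inner ℂ (x : H) (H₀ x + x)).re := by
    rw [inner_add_right, Complex.add_re]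
    have : (inner ℂ (x : H) (x : H)).re = ‖(x : H)‖ ^ 2 := (norm_sq_eq_re_inner (𝕜 := ℂ) _).symm
    linarith [hnonneg x]
  have h2 : (inner ℂ (x : H) (H₀ x + x)).re ≤ ‖(x : H)‖ * ‖H₀ x + x‖ :=
    re_inner_le_norm (𝕜 := ℂ) _ _
  rcases (norm_nonneg (x : H)).eq_or_lt with h | h
  · rw [← h]; positivity
  · nlinarith

/-- `H₀ + 1` is bounded below and has a closed, hence complete, graph, so its range is closed. A
vector `y` orthogonal to the range lies in the domain of `H₀* = H₀` with `H₀ y = -y`, and the lower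
bound gives `y = 0`. -/
theorem neg_one_mem_rho (hsa : IsSelfAdjoint H₀)
    (hnonneg : ∀ x : H₀.domain, 0 ≤ (inner ℂ (x : H) (H₀ x)).re) : (-1 : ℂ) ∈ rho H₀ := by
  have hcl : IsClosed (H₀.graph : Set (H × H)) := hsa.isClosed
  have : CompleteSpace H₀.graph := hcl.completeSpace_coe
  let Φ : H₀.graph →L[ℂ] H :=
    (ContinuousLinearMap.snd ℂ H H + ContinuousLinearMap.fst ℂ H H).comp H₀.graph.subtypeL
  have hΦ : ∀ p, Φ p = p.1.2 + p.1.1 := fun p => rfl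
  have hbound : ∀ p, ‖p‖ ≤ 2 * ‖Φ p‖ := by
    rintro ⟨⟨x, y⟩, hxy⟩
    obtain ⟨x', hx', hy'⟩ := (LinearPMap.mem_graph_iff H₀).1 hxy
    simp only at hx' hy'
    have h1 := norm_le_norm_add_of_nonneg hnonneg x'
    rw [hx', hy'] at h1
    have h2 : ‖y‖ ≤ ‖y + x‖ + ‖x‖ := by simpa using norm_sub_le (y + x) x
    rw [hΦ]
    simp only [Submodule.coe_norm, Prod.norm_def]
    exact max_le (by linarith [norm_nonneg x]) (by linarith)
  have hanti : AntilipschitzWith 2 Φ := Φ.antilipschitz_of_bound (by simpa using hbound)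
  have hrange : IsClosed (Set.range Φ) := hanti.isClosed_range Φ.uniformContinuous
  have hsurj : LinearMap.range (Φ : H₀.graph →ₗ[ℂ] H) = ⊤ := by
    have : CompleteSpace (LinearMap.range (Φ : H₀.graph →ₗ[ℂ] H)) :=
      IsComplete.completeSpace_coe (s := (LinearMap.range (Φ : H₀.graph →ₗ[ℂ] H) : Set H)) <| by
        exact hrange.isComplete
    rw [← Submodule.orthogonal_eq_bot_iff, Submodule.eq_bot_iff]
    intro y hy
    have h1 : ∀ x : H₀.domain, inner ℂ (-y) (x : H) = inner ℂ y (H₀ x) := fun x => by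
      have h2 : inner ℂ (Φ ⟨_, H₀.mem_graph x⟩) y = 0 :=
        (Submodule.mem_orthogonal _ _).1 hy _ ⟨_, rfl⟩
      have h3 : inner ℂ y (H₀ x + x) = 0 := inner_eq_zero_symm.1 h2
      rw [inner_add_right] at h3
      rw [inner_neg_left]
      exact (eq_neg_of_add_eq_zero_left h3).symm
    have hdom := LinearPMap.mem_adjoint_domain_of_exists y ⟨-y, h1⟩
    have happ := LinearPMap.adjoint_apply_eq hsa.dense_domain ⟨y, hdom⟩ h1
    have hgr : (y, -y) ∈ H₀.graph := by
      rw [← LinearPMap.isSelfAdjoint_def.1 hsa]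
      exact (LinearPMap.mem_graph_iff _).2 ⟨⟨y, hdom⟩, rfl, happ⟩
    obtain ⟨y', hy1, hy2⟩ := (LinearPMap.mem_graph_iff H₀).1 hgr
    simp only at hy1 hy2
    have h4 := norm_le_norm_add_of_nonneg hnonneg y'
    rw [hy1, hy2] at h4
    simpa using h4
  let e := ContinuousLinearEquiv.ofBijective Φ (LinearMap.ker_eq_bot.2 hanti.injective) hsurj
  have he : ∀ p, e p = p.1.2 + p.1.1 := fun p => rfl
  refine ⟨(ContinuousLinearMap.fst ℂ H H).comp (H₀.graph.subtypeL.comp (e.symm : H →L[ℂ] H₀.graph)),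
    isInverseAt_iff_mem_graph.2 fun x y => ?_⟩
  simp only [ContinuousLinearMap.comp_apply, ContinuousLinearEquiv.coe_coe, neg_smul, one_smul,
    sub_neg_eq_add, Submodule.subtypeL_apply, ContinuousLinearMap.coe_fst']
  constructor
  · intro h
    have : e.symm (y + x) = ⟨(x, y), h⟩ := e.symm_apply_eq.2 (he ⟨(x, y), h⟩).symm
    rw [this]
  · intro h
    have h1 : (e.symm (y + x)).1.2 + (e.symm (y + x)).1.1 = y + x := by
      rw [← he, e.apply_symm_apply]
    rw [h] at h1
    have h2 : (e.symm (y + x)).1 = (x, y) := Prod.ext h (add_right_cancel h1)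
    rw [← h2]
    exact (e.symm (y + x)).2

/-! ### The spectrum of `(H₀ + 1)⁻¹` and the resolvent set of `H₀` -/

variable (hsa : IsSelfAdjoint H₀) (hnonneg : ∀ x : H₀.domain, 0 ≤ (inner ℂ (x : H) (H₀ x)).re)
include hsa hnonneg

theorem exists_domain_of_neg_one (g : H) :
    ∃ x : H₀.domain, (x : H) = res H₀ (-1) g ∧ H₀ x + x = g := by
  obtain ⟨x, hx, hxg⟩ := (isInverseAt_res (neg_one_mem_rho hsa hnonneg)).1 g
  exact ⟨x, hx, by simpa using hxg⟩

theorem res_neg_one_nonneg : 0 ≤ res H₀ (-1) := by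
  rw [ContinuousLinearMap.nonneg_iff_isPositive, ContinuousLinearMap.isPositive_iff_complex]
  intro g
  obtain ⟨x, hx, hxg⟩ := exists_domain_of_neg_one hsa hnonneg g
  rw [← hx]
  have h1 : inner ℂ (x : H) g = inner ℂ (x : H) (H₀ x) + inner ℂ (x : H) (x : H) := by
    rw [← hxg, inner_add_right]
  rw [h1]
  have h2 : (starRingEnd ℂ) (inner ℂ (x : H) (H₀ x)) = inner ℂ (x : H) (H₀ x) := by
    rw [inner_conj_symm, inner_symm_of_isSelfAdjoint hsa]
  have h3 : (starRingEnd ℂ) (inner ℂ (x : H) (x : H)) = inner ℂ (x : H) (x : H) := by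
    rw [inner_conj_symm]
  constructor
  · have h5 : (starRingEnd ℂ) (inner ℂ (x : H) (H₀ x) + inner ℂ (x : H) (x : H)) =
        inner ℂ (x : H) (H₀ x) + inner ℂ (x : H) (x : H) := by rw [map_add, h2, h3]
    exact Complex.conj_eq_iff_re.1 h5
  · have h4 : 0 ≤ RCLike.re (inner ℂ (x : H) (x : H)) := inner_self_nonneg
    exact add_nonneg (hnonneg x) h4

theorem norm_res_neg_one_le : ‖res H₀ (-1)‖ ≤ 1 := by
  refine ContinuousLinearMap.opNorm_le_bound _ zero_le_one fun g => ?_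
  obtain ⟨x, hx, hxg⟩ := exists_domain_of_neg_one hsa hnonneg g
  have := norm_le_norm_add_of_nonneg hnonneg x
  rwa [hxg, hx, ← one_mul ‖g‖] at this

open scoped ComplexOrder in
theorem spectrum_res_neg_one {t : ℂ} (ht : t ∈ spectrum ℂ (res H₀ (-1))) :
    0 ≤ t.re ∧ t.re ≤ 1 ∧ t = t.re := by
  have h0 := spectrum_nonneg_of_nonneg (𝕜 := ℂ) (res_neg_one_nonneg hsa hnonneg) ht
  obtain ⟨h1, h2⟩ := Complex.nonneg_iff.1 h0
  refine ⟨h1, ?_, Complex.ext (by simp) (by simpa using h2.symm)⟩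
  -- The norm bound on the spectrum needs `‖1‖ = 1`; on the zero space the spectrum is empty.
  have : Nontrivial H := by
    by_contra hH
    rw [not_nontrivial_iff_subsingleton] at hH
    have : Subsingleton (H →L[ℂ] H) := inferInstance
    exact ht (isUnit_of_subsingleton _)
  exact (Complex.re_le_norm t).trans
    ((spectrum.norm_le_norm_of_mem ht).trans (norm_res_neg_one_le hsa hnonneg))

/-- Formally `1 - (1 + z) T = (H₀ - z) (H₀ + 1)⁻¹`, with inverse `(H₀ + 1) (H₀ - z)⁻¹ = 1 + (1 + z)
(H₀ - z)⁻¹`. -/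
theorem isUnit_of_mem_rho {z : ℂ} (hz : z ∈ rho H₀) : IsUnit (1 - (1 + z) • res H₀ (-1)) := by
  have h := isInverseAt_res (neg_one_mem_rho hsa hnonneg)
  have hz' := isInverseAt_res hz
  have h1 := hz'.sub_eq h
  have h2 := h.sub_eq hz'
  have hz1 : z - -1 = 1 + z := by ring
  have hz2 : -1 - z = -(1 + z) := by ring
  rw [hz1] at h1
  rw [hz2, neg_smul] at h2
  refine isUnit_iff_exists.2 ⟨1 + (1 + z) • res H₀ z, ?_, ?_⟩
  · have : (1 - (1 + z) • res H₀ (-1)) * (1 + (1 + z) • res H₀ z) =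
        1 - (1 + z) • (res H₀ (-1) - res H₀ z - -((1 + z) • (res H₀ (-1) * res H₀ z))) := by
      simp only [sub_mul, mul_add, one_mul, mul_one, smul_mul_assoc, mul_smul_comm]
      module
    rw [this, h2]
    simp
  · have : (1 + (1 + z) • res H₀ z) * (1 - (1 + z) • res H₀ (-1)) =
        1 + (1 + z) • (res H₀ z - res H₀ (-1) - (1 + z) • (res H₀ z * res H₀ (-1))) := by
      simp only [add_mul, mul_sub, one_mul, mul_one, smul_mul_assoc, mul_smul_comm]
      module
    rw [this, h1]
    simp

theorem isInverseAt_of_isUnit {z : ℂ} (hz : IsUnit (1 - (1 + z) • res H₀ (-1))) :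
    IsInverseAt H₀ z (res H₀ (-1) * Ring.inverse (1 - (1 + z) • res H₀ (-1))) := by
  have h := isInverseAt_res (neg_one_mem_rho hsa hnonneg)
  set T := res H₀ (-1)
  have hcomm : Commute T (1 - (1 + z) • T) :=
    (Commute.one_right T).sub_right ((Commute.refl T).smul_right _)
  have hcomm' : Commute T (Ring.inverse (1 - (1 + z) • T)) := by
    obtain ⟨u, hu⟩ := hz
    rw [← hu, Ring.inverse_unit]
    exact (hu ▸ hcomm : Commute T (u : H →L[ℂ] H)).units_inv_right
  have hr := Ring.mul_inverse_cancel _ hz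
  set Q := Ring.inverse (1 - (1 + z) • T)
  have hz1 : z - -1 = 1 + z := by ring
  rw [sub_mul, one_mul, smul_mul_assoc] at hr
  have key : T * Q - T = (1 + z) • (T * (T * Q)) := by
    rw [← mul_smul_comm, ← mul_sub_one, sub_eq_iff_eq_add'.2 (sub_eq_iff_eq_add.1 hr)]
  refine h.of_sub_eq ?_ ?_ <;> rw [hz1, key]
  rw [mul_assoc T Q T, hcomm'.eq]

/-- `1 - (1 + z) (H₀ + 1)⁻¹` is invertible exactly when `z` is in the resolvent set of `H₀`. -/
theorem mem_rho_iff {z : ℂ} : z ∈ rho H₀ ↔ IsUnit (1 - (1 + z) • res H₀ (-1)) :=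
  ⟨isUnit_of_mem_rho hsa hnonneg, fun h => ⟨_, isInverseAt_of_isUnit hsa hnonneg h⟩⟩

/-- Otherwise `(1 + z)⁻¹` would lie in the spectrum of `T`, contained in `[0, 1]`, forcing `1 + z ≥
1`. -/
theorem mem_rho_of_im_ne_zero_or_re_neg {z : ℂ} (hz : z.im ≠ 0 ∨ z.re < 0) : z ∈ rho H₀ := by
  rw [mem_rho_iff hsa hnonneg]
  rcases eq_or_ne (1 + z) 0 with h0 | h0
  · simp [h0]
  by_contra hcon
  have hmem : (1 + z)⁻¹ ∈ spectrum ℂ (res H₀ (-1)) := fun hu => hcon <| by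
    have : 1 - (1 + z) • res H₀ (-1) =
        (1 + z) • (algebraMap ℂ (H →L[ℂ] H) (1 + z)⁻¹ - res H₀ (-1)) := by
      rw [smul_sub, Algebra.algebraMap_eq_smul_one, smul_smul, mul_inv_cancel₀ h0, one_smul]
    rw [this]
    exact (isUnit_smul_iff (Units.mk0 _ h0) _).2 hu
  obtain ⟨h1, h2, h3⟩ := spectrum_res_neg_one hsa hnonneg hmem
  set t := (1 + z)⁻¹.re
  have h4 : 1 + z = ((t⁻¹ : ℝ) : ℂ) := by rw [Complex.ofReal_inv, ← h3, inv_inv]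
  have h5 : t ≠ 0 := fun h => h0 (by rw [h4, h]; simp)
  have h6 : 0 < t := lt_of_le_of_ne h1 h5.symm
  have h7 := (one_le_inv₀ h6).2 h2
  have h8 := congrArg Complex.re h4
  have h9 := congrArg Complex.im h4
  simp at h8 h9
  rcases hz with hz | hz
  · exact hz h9
  · linarith

/-- `ρ(H₀)` lies between the star-shaped set `ℂ \ [0, ∞)` and its closure, whatever gaps the
spectrum has. -/
theorem isPreconnected_rho : IsPreconnected (rho H₀) := by
  let S : Set ℂ := {z | -z ∈ Complex.slitPlane}
  have hS : IsPreconnected S := by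
    have : S = (fun z : ℂ => -z) '' Complex.slitPlane := by
      ext z
      simp [S]
    rw [this]
    exact (Complex.starConvex_one_slitPlane.isPathConnected
      Complex.one_mem_slitPlane).isConnected.isPreconnected.image _ continuous_neg.continuousOn
  refine hS.subset_closure (t := rho H₀) ?_ ?_
  · intro z hz
    refine mem_rho_of_im_ne_zero_or_re_neg hsa hnonneg ?_
    rcases hz with h | h
    · exact Or.inr (by simpa using h)
    · exact Or.inl (by simpa using h)
  · intro z _
    have ht : Tendsto (fun s : ℝ => z + (s : ℂ) * Complex.I) (𝓝[≠] 0) (𝓝 z) := by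
      have : Continuous fun s : ℝ => z + (s : ℂ) * Complex.I := by fun_prop
      simpa using (this.tendsto 0).mono_left nhdsWithin_le_nhds
    by_cases him : z.im = 0
    · refine mem_closure_of_tendsto ht ?_
      filter_upwards [self_mem_nhdsWithin] with s hs
      refine Or.inr ?_
      simpa [him] using hs
    · exact subset_closure (Or.inr (by simpa using him))

end NonnegSelfAdjoint

/-! ### The branch of the square root -/

theorem csqrt_sq (w : ℂ) : csqrt w ^ 2 = w := by
  have h1 : Complex.exp (((argNonneg w : ℝ) : ℂ) * Complex.I) =
      Complex.exp ((w.arg : ℂ) * Complex.I) := by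
    rw [argNonneg]
    split_ifs
    · rw [Complex.exp_eq_exp_iff_exists_int]
      exact ⟨1, by push_cast; ring⟩
    · rfl
  rw [csqrt, mul_pow, ← Complex.ofReal_pow, Real.sq_sqrt (norm_nonneg _), ← Complex.exp_nat_mul]
  have h2 : ((2 : ℕ) : ℂ) * (((argNonneg w / 2 : ℝ) : ℂ) * Complex.I) =
      ((argNonneg w : ℝ) : ℂ) * Complex.I := by push_cast; ring
  rw [h2, h1, Complex.norm_mul_exp_arg_mul_I]

theorem csqrt_real_mul {r : ℝ} (hr : 0 < r) (w : ℂ) :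
    csqrt (r * w) = (Real.sqrt r : ℂ) * csqrt w := by
  have h : argNonneg (r * w) = argNonneg w := by simp only [argNonneg, Complex.arg_real_mul w hr]
  rw [csqrt, csqrt, h, norm_mul, Complex.norm_real, Real.norm_of_nonneg hr.le,
    Real.sqrt_mul hr.le]
  push_cast
  ring

/-- The principal branch of the square root, with a cut along the negative half-line. -/
def principalSqrt (w : ℂ) : ℂ :=
  (Real.sqrt ‖w‖ : ℂ) * Complex.exp (((w.arg / 2 : ℝ) : ℂ) * Complex.I)

/-- For real `λ` the imaginary part of `λ - z` is `-Im z`. So for fixed `z` only one of the two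
half-planes occurs, and `csqrt` is the principal root up to one sign. -/
theorem csqrt_of_im_nonneg {w : ℂ} (hw : 0 ≤ w.im) : csqrt w = principalSqrt w := by
  rw [csqrt, principalSqrt, argNonneg, if_neg (not_lt.2 (Complex.arg_nonneg_iff.2 hw))]

theorem csqrt_of_im_neg {w : ℂ} (hw : w.im < 0) : csqrt w = -principalSqrt w := by
  rw [csqrt, principalSqrt, argNonneg, if_pos (Complex.arg_neg_iff.2 hw)]
  have : (((w.arg + 2 * Real.pi) / 2 : ℝ) : ℂ) * Complex.I =
      ((w.arg / 2 : ℝ) : ℂ) * Complex.I + Real.pi * Complex.I := by push_cast; ring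
  rw [this, Complex.exp_add, Complex.exp_pi_mul_I]
  ring

theorem principalSqrt_sq (w : ℂ) : principalSqrt w ^ 2 = w := by
  rcases le_or_gt 0 w.im with h | h
  · rw [← csqrt_of_im_nonneg h, csqrt_sq]
  · rw [← neg_sq, ← csqrt_of_im_neg h, csqrt_sq]

theorem continuousAt_principalSqrt {w : ℂ} (hw : w ∈ Complex.slitPlane) :
    ContinuousAt principalSqrt w := by
  have := Complex.continuousAt_arg hw
  unfold principalSqrt
  fun_prop

/-- On the cut the principal root is still continuous from above. This serves real `z` with spectrum
below it, where `1 - (1 + z) t` takes negative values. -/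
theorem continuousWithinAt_principalSqrt {w : ℂ} (hw : w ≠ 0) :
    ContinuousWithinAt principalSqrt {w | 0 ≤ w.im} w := by
  by_cases h : w ∈ Complex.slitPlane
  · exact (continuousAt_principalSqrt h).continuousWithinAt
  · obtain ⟨h1, h2⟩ := not_or.1 h
    have him : w.im = 0 := not_not.1 h2
    have hre : w.re < 0 := lt_of_le_of_ne (not_lt.1 h1) fun h3 => hw (Complex.ext h3 him)
    have := Complex.continuousWithinAt_arg_of_re_neg_of_im_zero hre him
    unfold principalSqrt
    fun_prop

/-! ### Square roots of the resolvent -/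

section

variable {H : Type*} [NormedAddCommGroup H] [InnerProductSpace ℂ H] [CompleteSpace H]
  {H₀ : H →ₗ.[ℂ] H}

/-- The symbol of `(1 - (1 + z) (H₀ + 1)⁻¹) ^ (-1/2)` in the spectral variable of `(H₀ + 1)⁻¹`. -/
def pencilSymbol (z t : ℂ) : ℂ :=
  -- The sign is fixed by `Im z`, not by `csqrt`: for `Im z > 0` the values `1 - (1 + z) t` approach
  -- `1` from below the cut of `csqrt` as `t` decreases to `0`, so `csqrt` would jump at `t = 0`.
  (if 0 < z.im then -principalSqrt (1 - (1 + z) * t) else principalSqrt (1 - (1 + z) * t))⁻¹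

/-- The operator `(1 - (1 + z) (H₀ + 1)⁻¹) ^ (-1/2)`. -/
def pencilInvSqrt (H₀ : H →ₗ.[ℂ] H) (z : ℂ) : H →L[ℂ] H :=
  cfc (pencilSymbol z) (res H₀ (-1))

theorem pencilSymbol_sq (z t : ℂ) : pencilSymbol z t ^ 2 = (1 - (1 + z) * t)⁻¹ := by
  rw [pencilSymbol, inv_pow]
  split_ifs
  · rw [neg_sq, principalSqrt_sq]
  · rw [principalSqrt_sq]

variable (hsa : IsSelfAdjoint H₀) (hnonneg : ∀ x : H₀.domain, 0 ≤ (inner ℂ (x : H) (H₀ x)).re)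
include hsa hnonneg

theorem pencil_ne_zero {z : ℂ} (hz : z ∈ rho H₀) {t : ℂ} (ht : t ∈ spectrum ℂ (res H₀ (-1))) :
    1 - (1 + z) * t ≠ 0 := by
  intro h
  have hu := isUnit_of_mem_rho hsa hnonneg hz
  have h1 : 1 + z ≠ 0 := fun h0 => by simp [h0] at h
  refine ht (show IsUnit (algebraMap ℂ (H →L[ℂ] H) t - res H₀ (-1)) from ?_)
  have h2 : t = (1 + z)⁻¹ := eq_inv_of_mul_eq_one_right (sub_eq_zero.1 h).symm
  have : algebraMap ℂ (H →L[ℂ] H) t - res H₀ (-1) =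
      (1 + z)⁻¹ • (1 - (1 + z) • res H₀ (-1)) := by
    rw [smul_sub, Algebra.algebraMap_eq_smul_one, smul_smul, inv_mul_cancel₀ h1, one_smul, h2]
  rw [this]
  exact (isUnit_smul_iff (Units.mk0 _ (inv_ne_zero h1)) _).2 hu

/-- On the spectrum `t ≥ 0` and `Im (1 - (1 + z) t) = -t Im z`. If `Im z > 0` the values stay in the
slit plane; otherwise they stay in the closed upper half-plane, where continuity from above
suffices. -/
theorem continuousOn_pencilSymbol {z : ℂ} (hz : z ∈ rho H₀) :
    ContinuousOn (pencilSymbol z) (spectrum ℂ (res H₀ (-1))) := by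
  have hsqrt : ContinuousOn (fun t : ℂ => principalSqrt (1 - (1 + z) * t))
      (spectrum ℂ (res H₀ (-1))) := by
    intro t ht
    have hne := pencil_ne_zero hsa hnonneg hz ht
    have hcont : Continuous fun t : ℂ => 1 - (1 + z) * t := by fun_prop
    have him : ∀ s ∈ spectrum ℂ (res H₀ (-1)),
        (1 - (1 + z) * s).im = -z.im * s.re ∧ 0 ≤ s.re := fun s hs => by
      obtain ⟨h1, -, h3⟩ := spectrum_res_neg_one hsa hnonneg hs
      refine ⟨?_, h1⟩
      rw [h3]
      simp
    by_cases hzim : 0 < z.im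
    · suffices hslit : 1 - (1 + z) * t ∈ Complex.slitPlane from
        (ContinuousAt.comp (f := fun t : ℂ => 1 - (1 + z) * t)
          (continuousAt_principalSqrt hslit) hcont.continuousAt).continuousWithinAt
      obtain ⟨h1, h2⟩ := him t ht
      rcases h2.eq_or_lt with h3 | h3
      · obtain ⟨-, -, h4⟩ := spectrum_res_neg_one hsa hnonneg ht
        rw [h4, ← h3]
        simp
      · refine Or.inr ?_
        rw [h1]
        exact mul_ne_zero (neg_ne_zero.2 hzim.ne') h3.ne'
    · refine ContinuousWithinAt.comp (t := {w | 0 ≤ w.im}) (f := fun t : ℂ => 1 - (1 + z) * t)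
        (continuousWithinAt_principalSqrt hne) hcont.continuousWithinAt fun s hs => ?_
      obtain ⟨h1, h2⟩ := him s hs
      change 0 ≤ (1 - (1 + z) * s).im
      rw [h1]
      exact mul_nonneg (by linarith) h2
  have hne : ∀ t ∈ spectrum ℂ (res H₀ (-1)), principalSqrt (1 - (1 + z) * t) ≠ 0 := fun t ht h0 =>
    pencil_ne_zero hsa hnonneg hz ht (by rw [← principalSqrt_sq (1 - (1 + z) * t), h0]; simp)
  unfold pencilSymbol
  split_ifs
  · exact hsqrt.neg.inv₀ fun t ht => neg_ne_zero.2 (hne t ht)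
  · exact hsqrt.inv₀ hne

theorem isSelfAdjoint_res_neg_one : IsSelfAdjoint (res H₀ (-1)) :=
  (res_neg_one_nonneg hsa hnonneg).isSelfAdjoint

/-- The factorization `(H₀ - z) ^ (-1/2) = (H₀ + 1) ^ (-1/2) (1 - (1 + z) (H₀ + 1)⁻¹) ^ (-1/2)`. -/
theorem invSqrt_eq {z : ℂ} (hz : z ∈ rho H₀) :
    invSqrt H₀ z = CFC.sqrt (res H₀ (-1)) * pencilInvSqrt H₀ z := by
  have hT := isSelfAdjoint_res_neg_one hsa hnonneg
  have hsqrt : CFC.sqrt (res H₀ (-1)) =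
      cfc (fun t : ℂ => ((Real.sqrt t.re : ℝ) : ℂ)) (res H₀ (-1)) := by
    rw [CFC.sqrt_eq_real_sqrt _ (res_neg_one_nonneg hsa hnonneg), cfcₙ_eq_cfc,
      cfc_real_eq_complex _ hT]
  have hcs : Continuous fun t : ℂ => ((Real.sqrt t.re : ℝ) : ℂ) := by fun_prop
  rw [hsqrt, pencilInvSqrt, ← cfc_mul _ _ _ hcs.continuousOn
    (continuousOn_pencilSymbol hsa hnonneg hz), invSqrt, funCalc]
  refine cfc_congr fun t ht => ?_
  obtain ⟨h1, -, h3⟩ := spectrum_res_neg_one hsa hnonneg ht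
  -- At `t = 0`, that is `λ = ∞`, both sides vanish: one by the convention in `funCalc`, the other
  -- through `√t`.
  rcases h1.eq_or_lt with h | h
  · rw [h3, ← h]
    simp
  · have ht0 : t ≠ 0 := fun h0 => by rw [h0] at h; simp at h
    rw [if_neg ht0]
    generalize t.re = s at *
    subst h3
    have hs : (s : ℂ) ≠ 0 := ht0
    -- With `λ = s⁻¹ - 1`, the positive factor `s⁻¹` leaves the root as `√(s⁻¹)`, whose reciprocal
    -- is the symbol of `T^(1/2)`.
    have h4 : ((s⁻¹ - 1 : ℝ) : ℂ) - z = ((s⁻¹ : ℝ) : ℂ) * (1 - (1 + z) * s) := by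
      push_cast
      field_simp
      ring
    rw [h4, csqrt_real_mul (inv_pos.2 h), Real.sqrt_inv, mul_inv, Complex.ofReal_inv, inv_inv,
      pencilSymbol]
    congr 2
    have him : (1 - (1 + z) * (s : ℂ)).im = -z.im * s := by simp
    split_ifs with hzim
    · exact csqrt_of_im_neg (by rw [him]; nlinarith)
    · exact csqrt_of_im_nonneg (by rw [him]; nlinarith)

theorem pencilInvSqrt_mul_self {z : ℂ} (hz : z ∈ rho H₀) :
    (1 - (1 + z) • res H₀ (-1)) * (pencilInvSqrt H₀ z * pencilInvSqrt H₀ z) = 1 := by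
  have hT : IsStarNormal (res H₀ (-1)) := (isSelfAdjoint_res_neg_one hsa hnonneg).isStarNormal
  have hb := continuousOn_pencilSymbol hsa hnonneg hz
  have hG : 1 - (1 + z) • res H₀ (-1) = cfc (fun t : ℂ => 1 - (1 + z) * t) (res H₀ (-1)) := by
    rw [cfc_sub .., cfc_const_one .., cfc_const_mul .., cfc_id' ..]
  have hG' : ContinuousOn (fun t : ℂ => 1 - (1 + z) * t) (spectrum ℂ (res H₀ (-1))) := by fun_prop
  rw [hG, pencilInvSqrt, ← cfc_mul _ _ _ hb hb, ← cfc_mul _ _ _ hG' (hb.fun_mul hb),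
    ← cfc_one ℂ (res H₀ (-1))]
  refine cfc_congr fun t ht => ?_
  simp only [Pi.one_apply]
  rw [← sq, pencilSymbol_sq, mul_inv_cancel₀ (pencil_ne_zero hsa hnonneg hz ht)]

theorem commute_pencilInvSqrt {z : ℂ} : Commute (res H₀ (-1)) (pencilInvSqrt H₀ z) := by
  have hT : IsStarNormal (res H₀ (-1)) := (isSelfAdjoint_res_neg_one hsa hnonneg).isStarNormal
  nth_rw 1 [← cfc_id ℂ (res H₀ (-1))]
  exact cfc_commute_cfc _ _ _

theorem commute_sqrt_pencilInvSqrt {z : ℂ} :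
    Commute (CFC.sqrt (res H₀ (-1))) (pencilInvSqrt H₀ z) := by
  have hT := isSelfAdjoint_res_neg_one hsa hnonneg
  rw [CFC.sqrt_eq_real_sqrt _ (res_neg_one_nonneg hsa hnonneg), cfcₙ_eq_cfc,
      cfc_real_eq_complex _ hT]
  exact cfc_commute_cfc _ _ _

theorem exists_unit_pencilInvSqrt {z : ℂ} (hz : z ∈ rho H₀) :
    ∃ B : (H →L[ℂ] H)ˣ, (B : H →L[ℂ] H) = pencilInvSqrt H₀ z ∧
      1 - (1 + z) • res H₀ (-1) = ((B⁻¹ * B⁻¹ : (H →L[ℂ] H)ˣ) : H →L[ℂ] H) := by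
  have h := pencilInvSqrt_mul_self hsa hnonneg hz
  have hc : Commute (1 - (1 + z) • res H₀ (-1)) (pencilInvSqrt H₀ z) :=
    (Commute.one_left _).sub_left ((commute_pencilInvSqrt hsa hnonneg).smul_left _)
  have hu : IsUnit (pencilInvSqrt H₀ z) := isUnit_iff_exists.2
    ⟨(1 - (1 + z) • res H₀ (-1)) * pencilInvSqrt H₀ z, by
      rw [← mul_assoc, ← hc.eq, mul_assoc, h], by rw [mul_assoc, h]⟩
  obtain ⟨B, hB⟩ := hu
  refine ⟨B, hB, ?_⟩
  rw [← hB, ← Units.val_mul] at h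
  rw [← mul_inv_rev]
  exact (Units.mul_eq_one_iff_eq_inv).1 h

/-! ### The maps between `𝓗₋₁`, `𝓗` and `𝓗₊₁` -/

/-- `T^(1/2) x = 0` gives `T x = 0`. This injectivity makes `LinearPMap.inverse` in `opSqrt` a
genuine inverse. -/
theorem ker_sqrt_eq_bot : (((CFC.sqrt (res H₀ (-1)) : H →L[ℂ] H).toLinearMap.toPMap ⊤).toFun).ker
    = ⊥ := by
  rw [LinearMap.ker_eq_bot']
  intro x hx
  have hx' : CFC.sqrt (res H₀ (-1)) (x : H) = 0 := hx
  have h1 : res H₀ (-1) (x : H) = 0 := by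
    rw [← CFC.sqrt_mul_sqrt_self _ (res_neg_one_nonneg hsa hnonneg), mul_apply_eq_comp, hx',
      map_zero]
  exact Subtype.ext ((isInverseAt_res (neg_one_mem_rho hsa hnonneg)).injective
    (h1.trans (map_zero _).symm))

/-- `(H₀ + 1) ^ (-1/2)` maps `𝓗` boundedly into `𝓗₊₁(H₀)`. -/
theorem exists_toPlus_sqrt : ∃ L : H →L[ℂ] HPlus H₀,
    ∀ f, HPlus.incl H₀ (L f) = CFC.sqrt (res H₀ (-1)) f := by
  let q : H →L[ℂ] H := CFC.sqrt (res H₀ (-1))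
  have hker := ker_sqrt_eq_bot hsa hnonneg
  have hdom : ∀ f, q f ∈ (opSqrt H₀).domain := fun f => by
    change q f ∈ (LinearPMap.inverse _).domain
    rw [LinearPMap.inverse_domain]
    exact ⟨⟨f, trivial⟩, rfl⟩
  have happ : ∀ f, opSqrt H₀ ⟨q f, hdom f⟩ = (CFC.sqrt (1 - res H₀ (-1)) : H →L[ℂ] H) f :=
    fun f => by
      change (CFC.sqrt (1 - res H₀ (-1)) : H →L[ℂ] H) (LinearPMap.inverse _ ⟨q f, hdom f⟩) = _
      congr 1
      exact LinearPMap.inverse_apply_eq hker (x := ⟨f, trivial⟩) rfl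
  let L₀ : H →ₗ[ℂ] HPlus H₀ :=
    { toFun := fun f => (⟨q f, hdom f⟩ : (opSqrt H₀).domain)
      map_add' := fun f g => Subtype.ext (map_add q f g)
      map_smul' := fun c f => Subtype.ext (map_smul q c f) }
  refine ⟨L₀.mkContinuous (‖(CFC.sqrt (1 - res H₀ (-1)) : H →L[ℂ] H)‖ + ‖q‖) fun f => ?_,
    fun f => rfl⟩
  -- By `happ`, `H₀^(1/2) T^(1/2) = (1 - T)^(1/2)`, so the norm of `𝓗₊₁` involves only bounded
  -- operators.
  have hn : ‖L₀ f‖ ^ 2 = ‖(CFC.sqrt (1 - res H₀ (-1)) : H →L[ℂ] H) f‖ ^ 2 + ‖q f‖ ^ 2 := by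
    rw [norm_sq_eq_re_inner (𝕜 := ℂ), HPlus.inner_def, map_add, ← norm_sq_eq_re_inner,
      ← norm_sq_eq_re_inner]
    congr 3
    exact happ f
  have h1 := (CFC.sqrt (1 - res H₀ (-1)) : H →L[ℂ] H).le_opNorm f
  have h2 := q.le_opNorm f
  have h3 : ‖L₀ f‖ ≤ ‖(CFC.sqrt (1 - res H₀ (-1)) : H →L[ℂ] H) f‖ + ‖q f‖ := by
    refine abs_le_of_sq_le_sq' ?_ (by positivity) |>.2
    rw [hn]
    nlinarith [mul_nonneg (norm_nonneg ((CFC.sqrt (1 - res H₀ (-1)) : H →L[ℂ] H) f))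
      (norm_nonneg (q f))]
  linarith

theorem toPlus_sqrt_mul (B : H →L[ℂ] H) : toPlus H₀ (CFC.sqrt (res H₀ (-1)) * B) =
    (toPlus H₀ (CFC.sqrt (res H₀ (-1)))).comp B := by
  obtain ⟨L, hL⟩ := exists_toPlus_sqrt hsa hnonneg
  rw [toPlus_eq hL]
  exact toPlus_eq fun f => hL (B f)

/-- By duality, with `T^(1/2)` self-adjoint: `(g, B T^(1/2) Ψ) = Ψ (T^(1/2) B* g) = (B* g, T^(1/2)
Ψ)`. -/
theorem fromMinus_mul_sqrt (B : H →L[ℂ] H) : fromMinus H₀ (B * CFC.sqrt (res H₀ (-1))) =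
    B.comp (fromMinus H₀ (CFC.sqrt (res H₀ (-1)))) := by
  have hq : ContinuousLinearMap.adjoint (CFC.sqrt (res H₀ (-1)) : H →L[ℂ] H) =
      CFC.sqrt (res H₀ (-1)) :=
    (ContinuousLinearMap.isSelfAdjoint_iff'.1 (CFC.sqrt_nonneg (res H₀ (-1))).isSelfAdjoint)
  ext Ψ
  refine ext_inner_left ℂ fun g => ?_
  have h1 : ContinuousLinearMap.adjoint (B * CFC.sqrt (res H₀ (-1))) =
      CFC.sqrt (res H₀ (-1)) * ContinuousLinearMap.adjoint B := by
    change ContinuousLinearMap.adjoint (B.comp _) = _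
    rw [ContinuousLinearMap.adjoint_comp, hq]
    rfl
  rw [inner_fromMinus, h1, toPlus_sqrt_mul hsa hnonneg, ContinuousLinearMap.comp_apply,
    ContinuousLinearMap.comp_apply, ← ContinuousLinearMap.adjoint_inner_left, inner_fromMinus, hq]

end

/-! ### The operator pencil of the perturbation -/

section Pencil

variable {H : Type*} [NormedAddCommGroup H] [InnerProductSpace ℂ H] [CompleteSpace H]
  {H₀ : H →ₗ.[ℂ] H}

/-- The bounded operator `(H₀ + 1) ^ (-1/2) V (H₀ + 1) ^ (-1/2)`. -/
def formOperator (H₀ : H →ₗ.[ℂ] H) (V : HPlus H₀ →L[ℂ] HMinus H₀) : H →L[ℂ] H :=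
  (fromMinus H₀ (CFC.sqrt (res H₀ (-1)))).comp (V.comp (toPlus H₀ (CFC.sqrt (res H₀ (-1)))))

/-- The bounded operator `(H₀ + 1) ^ (-1/2) (H₀ + V - z) (H₀ + 1) ^ (-1/2)`. -/
def pencil (H₀ : H →ₗ.[ℂ] H) (V : HPlus H₀ →L[ℂ] HMinus H₀) (z : ℂ) : H →L[ℂ] H :=
  (1 - (1 + z) • res H₀ (-1)) + formOperator H₀ V

/-- The resolvent `(H₀ + 1) ^ (-1/2) P(z)⁻¹ (H₀ + 1) ^ (-1/2)`, where `P(z)` is the pencil. -/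
def pencilResolvent (H₀ : H →ₗ.[ℂ] H) (V : HPlus H₀ →L[ℂ] HMinus H₀) (z : ℂ) : H →L[ℂ] H :=
  CFC.sqrt (res H₀ (-1)) * Ring.inverse (pencil H₀ V z) * CFC.sqrt (res H₀ (-1))

variable (hsa : IsSelfAdjoint H₀) (hnonneg : ∀ x : H₀.domain, 0 ≤ (inner ℂ (x : H) (H₀ x)).re)
  {V : HPlus H₀ →L[ℂ] HMinus H₀}
include hsa hnonneg

/-- Since `B` commutes with `T^(1/2)`, the factor `T^(1/2)` can be placed next to `V` on both sides.
-/
theorem birmanSchwinger_eq {z : ℂ} (hz : z ∈ rho H₀) : birmanSchwinger H₀ V z =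
    -(pencilInvSqrt H₀ z * formOperator H₀ V * pencilInvSqrt H₀ z) := by
  have h1 := invSqrt_eq hsa hnonneg hz
  have h2 : invSqrt H₀ z = pencilInvSqrt H₀ z * CFC.sqrt (res H₀ (-1)) := by
    rw [h1, (commute_sqrt_pencilInvSqrt hsa hnonneg).eq]
  have h3 : toPlus H₀ (invSqrt H₀ z) =
      (toPlus H₀ (CFC.sqrt (res H₀ (-1)))).comp (pencilInvSqrt H₀ z) := by
    rw [h1, toPlus_sqrt_mul hsa hnonneg]
  have h4 : fromMinus H₀ (invSqrt H₀ z) =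
      (pencilInvSqrt H₀ z).comp (fromMinus H₀ (CFC.sqrt (res H₀ (-1)))) := by
    rw [h2, fromMinus_mul_sqrt hsa hnonneg]
  rw [birmanSchwinger, h3, h4]
  rfl

/-- `1 + B v B = B (B⁻² + v) B`, and `B⁻² = 1 - (1 + z) T`. -/
theorem exists_one_sub_birmanSchwinger_eq {z : ℂ} (hz : z ∈ rho H₀) : ∃ B : (H →L[ℂ] H)ˣ,
    (B : H →L[ℂ] H) = pencilInvSqrt H₀ z ∧
      1 - birmanSchwinger H₀ V z = B * pencil H₀ V z * B := by
  obtain ⟨B, hB, hG⟩ := exists_unit_pencilInvSqrt hsa hnonneg hz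
  refine ⟨B, hB, ?_⟩
  rw [birmanSchwinger_eq hsa hnonneg hz, ← hB, pencil, hG]
  simp only [mul_add, add_mul, sub_neg_eq_add, Units.val_mul, Units.mul_inv_cancel_left,
    Units.inv_mul]

theorem isUnit_one_sub_birmanSchwinger_iff {z : ℂ} (hz : z ∈ rho H₀) :
    IsUnit (1 - birmanSchwinger H₀ V z) ↔ IsUnit (pencil H₀ V z) := by
  obtain ⟨B, -, h⟩ := exists_one_sub_birmanSchwinger_eq hsa hnonneg (V := V) hz
  rw [h, Units.isUnit_mul_units, Units.isUnit_units_mul]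

theorem mem_exceptionalSet_iff {z : ℂ} :
    z ∈ exceptionalSet H₀ V ↔ z ∈ rho H₀ ∧ ¬ IsUnit (pencil H₀ V z) := by
  refine and_congr_right fun hz => not_congr ?_
  rw [← isUnit_one_sub_birmanSchwinger_iff hsa hnonneg hz, spectrum.mem_resolventSet_iff, map_one]

theorem tiktopoulos_eq {z : ℂ} (hz : z ∈ rho H₀) :
    tiktopoulos H₀ V z = pencilResolvent H₀ V z := by
  obtain ⟨B, hB, h⟩ := exists_one_sub_birmanSchwinger_eq hsa hnonneg (V := V) hz
  have h1 := invSqrt_eq hsa hnonneg hz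
  have h2 : invSqrt H₀ z = B * CFC.sqrt (res H₀ (-1)) := by
    rw [h1, hB, (commute_sqrt_pencilInvSqrt hsa hnonneg).eq]
  rw [← hB] at h1
  have h3 : Ring.inverse (1 - birmanSchwinger H₀ V z) =
      ((B⁻¹ : (H →L[ℂ] H)ˣ) : H →L[ℂ] H) * Ring.inverse (pencil H₀ V z) *
        ((B⁻¹ : (H →L[ℂ] H)ˣ) : H →L[ℂ] H) := by
    by_cases hu : IsUnit (pencil H₀ V z)
    · obtain ⟨u, hu⟩ := hu
      rw [h, ← hu, Ring.inverse_unit, ← Units.val_mul, ← Units.val_mul, Ring.inverse_unit,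
        mul_inv_rev, mul_inv_rev, Units.val_mul, Units.val_mul, mul_assoc]
    -- At an exceptional point both `Ring.inverse` terms default to `0`.
    · have hu' := mt (isUnit_one_sub_birmanSchwinger_iff hsa hnonneg hz).1 hu
      rw [Ring.inverse_non_unit _ hu, Ring.inverse_non_unit _ hu', mul_zero, zero_mul]
  rw [tiktopoulos, pencilResolvent, h3]
  nth_rw 1 [h1]
  rw [h2]
  simp only [mul_assoc, Units.mul_inv_cancel_left, Units.inv_mul_cancel_left]

/-- `v = -B⁻¹ A_V(z) B⁻¹` does not depend on `z`, so compactness at one point serves all. -/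
theorem isCompactOperator_formOperator {z : ℂ} (hz : z ∈ rho H₀)
    (h : IsCompactOperator (birmanSchwinger H₀ V z)) : IsCompactOperator (formOperator H₀ V) := by
  obtain ⟨B, hB, -⟩ := exists_unit_pencilInvSqrt hsa hnonneg hz
  rw [birmanSchwinger_eq hsa hnonneg hz, ← hB] at h
  have h1 : formOperator H₀ V = -(((B⁻¹ : (H →L[ℂ] H)ˣ) : H →L[ℂ] H) *
      -(B * formOperator H₀ V * B) * ((B⁻¹ : (H →L[ℂ] H)ˣ) : H →L[ℂ] H)) := by
    simp [mul_assoc]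
  rw [h1]
  exact ((h.clm_comp ((B⁻¹ : (H →L[ℂ] H)ˣ) : H →L[ℂ] H)).comp_clm
    ((B⁻¹ : (H →L[ℂ] H)ˣ) : H →L[ℂ] H)).neg

/-- The pencil resolvents form a pseudoresolvent. -/
theorem pencilResolvent_sub_eq {z w : ℂ} (hz : IsUnit (pencil H₀ V z))
    (hw : IsUnit (pencil H₀ V w)) : pencilResolvent H₀ V z - pencilResolvent H₀ V w =
      (z - w) • (pencilResolvent H₀ V z * pencilResolvent H₀ V w) := by
  have hq := CFC.sqrt_mul_sqrt_self _ (res_neg_one_nonneg hsa hnonneg)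
  -- The perturbation cancels; writing `T = T^(1/2) T^(1/2)` then splits the middle factor between
  -- the two resolvents.
  have hd : pencil H₀ V w - pencil H₀ V z = (z - w) • res H₀ (-1) := by
    simp only [pencil]
    module
  have h1 := Ring.inverse_mul_cancel _ hz
  have h2 := Ring.mul_inverse_cancel _ hw
  have key : Ring.inverse (pencil H₀ V z) - Ring.inverse (pencil H₀ V w) =
      (z - w) • (Ring.inverse (pencil H₀ V z) * res H₀ (-1) * Ring.inverse (pencil H₀ V w)) := by
    rw [← smul_mul_assoc, ← mul_smul_comm, ← hd, mul_sub, sub_mul, h1, one_mul, mul_assoc, h2,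
      mul_one]
  simp only [pencilResolvent]
  rw [← sub_mul, ← mul_sub, key]
  nth_rw 2 [← hq]
  simp only [mul_assoc, smul_mul_assoc, mul_smul_comm]

/-! ### Injectivity, dense range and compact differences of the perturbed resolvents -/

theorem injective_sqrt_res : Function.Injective (CFC.sqrt (res H₀ (-1)) : H →L[ℂ] H) := by
  refine (injective_iff_map_eq_zero _).2 fun x hx => ?_
  have := (LinearMap.ker_eq_bot'.1 (ker_sqrt_eq_bot hsa hnonneg)) ⟨x, trivial⟩ hx
  exact congrArg Subtype.val this

theorem denseRange_sqrt_res : DenseRange (CFC.sqrt (res H₀ (-1)) : H →L[ℂ] H) := by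
  let q : H →L[ℂ] H := CFC.sqrt (res H₀ (-1))
  have hq : ContinuousLinearMap.adjoint q = q :=
    ContinuousLinearMap.isSelfAdjoint_iff'.1 (CFC.sqrt_nonneg (res H₀ (-1))).isSelfAdjoint
  have h : (LinearMap.range (q : H →ₗ[ℂ] H))ᗮ = ⊥ := by
    rw [ContinuousLinearMap.orthogonal_range, hq]
    exact LinearMap.ker_eq_bot.2 (injective_sqrt_res hsa hnonneg)
  have h' := Submodule.dense_iff_topologicalClosure_eq_top.2
    ((Submodule.topologicalClosure_eq_top_iff).2 h)
  exact h'

theorem injective_pencilResolvent {z : ℂ} (hz : IsUnit (pencil H₀ V z)) :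
    Function.Injective (pencilResolvent H₀ V z) := by
  have hq := injective_sqrt_res hsa hnonneg
  refine hq.comp (Function.Injective.comp
    (g := (Ring.inverse (pencil H₀ V z) : H →L[ℂ] H)) ?_ hq)
  refine Function.LeftInverse.injective (g := pencil H₀ V z) fun x => ?_
  rw [← mul_apply_eq_comp, Ring.mul_inverse_cancel _ hz]
  rfl

theorem denseRange_pencilResolvent {z : ℂ} (hz : IsUnit (pencil H₀ V z)) :
    DenseRange (pencilResolvent H₀ V z) := by
  have hq := denseRange_sqrt_res hsa hnonneg
  have hs : Function.Surjective (Ring.inverse (pencil H₀ V z) : H →L[ℂ] H) :=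
    Function.RightInverse.surjective (g := pencil H₀ V z) fun x => by
      rw [← mul_apply_eq_comp, Ring.inverse_mul_cancel _ hz]
      rfl
  exact hq.comp (hs.denseRange.comp hq (ContinuousLinearMap.continuous _))
    (ContinuousLinearMap.continuous _)

/-- The second resolvent identity: with `G = 1 - (1 + z) T` and `P = G + v`, `P⁻¹ - G⁻¹ = -P⁻¹ v
G⁻¹`, multiplied by `T^(1/2)` on both sides. -/
theorem isCompactOperator_pencilResolvent_sub {z : ℂ} (hz : z ∈ rho H₀)
    (hu : IsUnit (pencil H₀ V z)) (hv : IsCompactOperator (formOperator H₀ V)) :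
    IsCompactOperator (pencilResolvent H₀ V z - res H₀ z) := by
  have hG := isUnit_of_mem_rho hsa hnonneg hz
  have hq := CFC.sqrt_mul_sqrt_self _ (res_neg_one_nonneg hsa hnonneg)
  set q : H →L[ℂ] H := CFC.sqrt (res H₀ (-1)) with hqdef
  have hcomm : Commute q (Ring.inverse (1 - (1 + z) • res H₀ (-1))) := by
    have hqT : Commute q (res H₀ (-1)) := by
      rw [← hq]
      exact (Commute.refl q).mul_right (Commute.refl q)
    obtain ⟨u, hu'⟩ := hG
    rw [← hu', Ring.inverse_unit]
    refine Commute.units_inv_right ?_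
    rw [hu']
    exact (Commute.one_right q).sub_right (hqT.smul_right _)
  have hres : res H₀ z = q * Ring.inverse (1 - (1 + z) • res H₀ (-1)) * q := by
    rw [(isInverseAt_of_isUnit hsa hnonneg hG).res_eq, mul_assoc, ← hcomm.eq, ← mul_assoc, hq]
  have hdiff : pencilResolvent H₀ V z - res H₀ z =
      -((q * Ring.inverse (pencil H₀ V z)) * formOperator H₀ V *
        (Ring.inverse (1 - (1 + z) • res H₀ (-1)) * q)) := by
    have h1 := Ring.inverse_mul_cancel _ hu
    have h2 := Ring.mul_inverse_cancel _ hG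
    have hv' : formOperator H₀ V = pencil H₀ V z - (1 - (1 + z) • res H₀ (-1)) := by
      simp [pencil]
    rw [hres, pencilResolvent, ← hqdef, hv']
    generalize 1 - (1 + z) • res H₀ (-1) = G at *
    generalize pencil H₀ V z = F at *
    have h3 : Ring.inverse F * (F - G) * Ring.inverse G = Ring.inverse G - Ring.inverse F := by
      rw [mul_sub, sub_mul, h1, one_mul, mul_assoc, h2, mul_one]
    have h4 : q * Ring.inverse F * (F - G) * (Ring.inverse G * q) =
        q * (Ring.inverse F * (F - G) * Ring.inverse G) * q := by simp only [mul_assoc]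
    rw [h4, h3, mul_sub, sub_mul, neg_sub]
  rw [hdiff]
  exact ((hv.clm_comp (q * Ring.inverse (pencil H₀ V z))).comp_clm
    (Ring.inverse (1 - (1 + z) • res H₀ (-1)) * q)).neg

omit hsa hnonneg [CompleteSpace H] in
/-- Compactness of the difference of two resolvents does not depend on the point. -/
theorem isCompactOperator_resolvent_sub {T S : H →ₗ.[ℂ] H} {z w : ℂ} {Tz Tw Sz Sw : H →L[ℂ] H}
    (hTz : IsInverseAt T z Tz) (hTw : IsInverseAt T w Tw) (hSz : IsInverseAt S z Sz)
    (hSw : IsInverseAt S w Sw) (h : IsCompactOperator (Tw - Sw)) :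
    IsCompactOperator (Tz - Sz) := by
  have h1 : Tz = (1 + (z - w) • Tz) * Tw := by
    rw [add_mul, one_mul, smul_mul_assoc, ← hTz.sub_eq hTw]
    abel
  have h2 : Sz = Sw * (1 + (z - w) • Sz) := by
    rw [mul_add, mul_one, mul_smul_comm, ← neg_sub w z, neg_smul, ← hSw.sub_eq hSz]
    abel
  have h3 : Tz = Tw * (1 + (z - w) • Tz) := by
    rw [mul_add, mul_one, mul_smul_comm, ← neg_sub w z, neg_smul, ← hTw.sub_eq hTz]
    abel
  have h4 : Sz = (1 + (z - w) • Sz) * Sw := by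
    rw [add_mul, one_mul, smul_mul_assoc, ← hSz.sub_eq hSw]
    abel
  -- The outer factors are `(T - w) (T - z)⁻¹` and `(S - w) (S - z)⁻¹`, written as bounded
  -- operators.
  have key : Tz - Sz = (1 + (z - w) • Tz) * (Tw - Sw) * (1 + (z - w) • Sz) := by
    rw [mul_sub, sub_mul, ← h1, mul_assoc _ Sw, ← h2]
    simp only [mul_add, add_mul, mul_one, one_mul, smul_mul_assoc, mul_smul_comm]
    abel
  rw [key]
  exact (h.clm_comp (1 + (z - w) • Tz)).comp_clm (1 + (z - w) • Sz)

end Pencil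

end FormPerturbation

end

/-! ### The main theorem -/

theorem theorem2p9 {H : Type*} [NormedAddCommGroup H] [InnerProductSpace ℂ H] [CompleteSpace H]
    [TopologicalSpace.SeparableSpace H]
    (H₀ : H →ₗ.[ℂ] H) (hsa : IsSelfAdjoint H₀)
    (hnonneg : ∀ x : H₀.domain, 0 ≤ (inner ℂ (x : H) (H₀ x)).re)
    (V : FormPerturbation.HPlus H₀ →L[ℂ] FormPerturbation.HMinus H₀)
    (z₀ : ℂ) (hz₀ : z₀ ∈ FormPerturbation.rho H₀)
    (hcompact : IsCompactOperator (FormPerturbation.birmanSchwinger H₀ V z₀))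
    (E₀ : ℝ) (hE₀ : E₀ < 0) (hnorm : ‖FormPerturbation.birmanSchwinger H₀ V (E₀ : ℂ)‖ < 1) :
    -- the exceptional set has no accumulation point in `ρ(H₀)`
    (∀ z ∈ FormPerturbation.rho H₀,
      ¬ AccPt z (𝓟 (FormPerturbation.exceptionalSet H₀ V))) ∧
    ∃ H₁ : H →ₗ.[ℂ] H,
      Dense (H₁.domain : Set H) ∧ H₁.IsClosed ∧
      -- `R(z)` is the resolvent of `H₁` at every nonexceptional point `z` of `ρ(H₀)`
      FormPerturbation.rho H₀ \ FormPerturbation.exceptionalSet H₀ V ⊆ FormPerturbation.rho H₁ ∧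
      (∀ z ∈ FormPerturbation.rho H₀ \ FormPerturbation.exceptionalSet H₀ V,
        FormPerturbation.tiktopoulos H₀ V z = FormPerturbation.res H₁ z) ∧
      -- `H₁` is determined by `R(z)` at any single such `z`
      (∀ z ∈ FormPerturbation.rho H₀ \ FormPerturbation.exceptionalSet H₀ V,
        ∀ H₂ : H →ₗ.[ℂ] H, Dense (H₂.domain : Set H) → H₂.IsClosed →
          z ∈ FormPerturbation.rho H₂ →
          FormPerturbation.tiktopoulos H₀ V z = FormPerturbation.res H₂ z → H₂ = H₁) ∧
      -- the resolvent difference is compact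
      (∀ z ∈ FormPerturbation.rho H₀ ∩ FormPerturbation.rho H₁,
        IsCompactOperator (FormPerturbation.res H₁ z - FormPerturbation.res H₀ z)) := by
  open FormPerturbation in
  have hE : (E₀ : ℂ) ∈ rho H₀ := mem_rho_of_im_ne_zero_or_re_neg hsa hnonneg (Or.inr (by simpa))
  have hv := isCompactOperator_formOperator hsa hnonneg hz₀ hcompact
  have huE : IsUnit (pencil H₀ V E₀) :=
    (isUnit_one_sub_birmanSchwinger_iff hsa hnonneg hE).1 (isUnit_one_sub_of_norm_lt_one hnorm)
  have hunit : ∀ z ∈ rho H₀ \ exceptionalSet H₀ V, IsUnit (pencil H₀ V z) := fun z hz => by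
    by_contra hcon
    exact hz.2 ((mem_exceptionalSet_iff hsa hnonneg).2 ⟨hz.1, hcon⟩)
  -- `E₀` is the base point: the norm bound makes it nonexceptional, so `R(E₀)` can define the
  -- operator.
  obtain ⟨H₁, hH₁⟩ := exists_isInverseAt (injective_pencilResolvent hsa hnonneg huE) (E₀ : ℂ)
  have hinv : ∀ z ∈ rho H₀ \ exceptionalSet H₀ V, IsInverseAt H₁ z (tiktopoulos H₀ V z) := by
    intro z hz
    rw [tiktopoulos_eq hsa hnonneg hz.1]
    refine hH₁.of_sub_eq (pencilResolvent_sub_eq hsa hnonneg (hunit z hz) huE) ?_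
    rw [← neg_sub, pencilResolvent_sub_eq hsa hnonneg huE (hunit z hz), ← neg_smul, neg_sub]
  refine ⟨fun z hz => ?_, H₁, ?_, hH₁.isClosed, fun z hz => ⟨_, hinv z hz⟩,
    fun z hz => (hinv z hz).res_eq.symm, fun z hz H₂ _ _ hz₂ h₂ => ?_, fun z hz => ?_⟩
  · have hev := eventually_isUnit_of_isPreconnected (G := fun z => 1 - (1 + z) • res H₀ (-1))
      (isPreconnected_rho hsa hnonneg)
      (fun z _ => by fun_prop) (fun z hz => isUnit_of_mem_rho hsa hnonneg hz) hv hE huE hz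
    rw [accPt_iff_frequently_nhdsNE, Filter.not_frequently]
    filter_upwards [hev] with w hw hmem
    exact ((mem_exceptionalSet_iff hsa hnonneg).1 hmem).2 hw
  · rw [hH₁.domain_eq]
    exact denseRange_pencilResolvent hsa hnonneg huE
  · have h := isInverseAt_res hz₂
    rw [← h₂] at h
    exact h.operator_unique (hinv z hz)
  -- Here `z` is not known to be nonexceptional, so `R(z)` is unavailable and compactness is carried
  -- over from `E₀`.
  · exact isCompactOperator_resolvent_sub (isInverseAt_res hz.2) hH₁ (isInverseAt_res hz.1)
      (isInverseAt_res hE) (isCompactOperator_pencilResolvent_sub hsa hnonneg hE huE hv)
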